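/- Let $r>0$ and consider the distributed delay differential equation $$x'(t)=-\int_0^1 r\sin\bigl(x(t-s)\bigr)\,ds,\qquad t\in\mathbb R. \tag{1}$$ A special symmetric periodic solution (SSPS) of (1) is a solution $x:\mathbb R\to\mathbb R$ which is periodic with minimal period $2$ and satisfies $x(t)+x(t-1)=0$ for all $t\in\mathbb R$. For $0\le k<1$ let $F(\varphi,k)=\int_0^{\varphi}\frac{d\theta}{\sqrt{1-k^2\sin^2\theta}}$, let $K(k)=F(\pi/2,k)$ be the complete elliptic integral of the first kind, and let $\operatorname{sn}(u,k)=\sin\varphi$, where $\varphi\in\mathbb R$ is the unique number with $F(\varphi,k)=u$, be the Jacobi elliptic sine with modulus $k$. Equation (1) has an SSPS if and only if $r>\pi^2/2$. If $r>\pi^2/2$, then the equation $$\frac{2K(\sqrt a)}{\sqrt{2r}}=1$$ has a unique solution $a\in(0,1)$, the function $$x(t)=2\arcsin\bigl(\sqrt a\,\operatorname{sn}(\sqrt{2r}\,t,\sqrt a)\bigr),\qquad t\in\mathbb R,$$ is an SSPS of (1), and every SSPS of (1) is of the form $t\mapsto x(t+t_0)$ for some $t_0\in\mathbb R$. -/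

import Mathlib

noncomputable section

/-- Incomplete elliptic integral of the first kind (Legendre form), amplitude `φ`, modulus `k`. -/
def ellipticF (φ k : ℝ) : ℝ :=
  ∫ θ in (0 : ℝ)..φ, 1 / Real.sqrt (1 - k ^ 2 * Real.sin θ ^ 2)

/-- Complete elliptic integral of the first kind with modulus `k`. -/
def ellipticK (k : ℝ) : ℝ := ellipticF (Real.pi / 2) k

/-- Jacobi amplitude: the inverse of `φ ↦ ellipticF φ k`, which is a bijection of `ℝ` for
`k ^ 2 < 1` (see `ellipticF_jacobiAm`, `jacobiAm_ellipticF`). -/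
def jacobiAm (u k : ℝ) : ℝ := Function.invFun (fun φ => ellipticF φ k) u

/-- Jacobi elliptic sine with argument `u` and modulus `k`. -/
def jacobiSn (u k : ℝ) : ℝ := Real.sin (jacobiAm u k)

/-- `x : ℝ → ℝ` solves `x'(t) = -∫₀¹ f (x (t - s)) ds` on the whole line. -/
def IsSolutionDDE (f x : ℝ → ℝ) : Prop :=
  ∀ t : ℝ, HasDerivAt x (-∫ s in (0 : ℝ)..1, f (x (t - s))) t

/-- Special symmetric periodic solution: a solution with minimal period `2` such that
`x(t) + x(t - 1) = 0` for all `t`. -/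
structure IsSSPS (f x : ℝ → ℝ) : Prop where
  isSolution : IsSolutionDDE f x
  minimalPeriod : IsLeast {T : ℝ | 0 < T ∧ Function.Periodic x T} 2
  symmetric : ∀ t : ℝ, x t + x (t - 1) = 0

theorem ellipticF_bijective {k : ℝ} (hk : k ^ 2 < 1) :
    Function.Bijective (fun φ => ellipticF φ k) := by
  have hpos : ∀ θ : ℝ, 0 < 1 - k ^ 2 * Real.sin θ ^ 2 := fun θ => by
    nlinarith [Real.sin_sq_le_one θ, sq_nonneg (Real.sin θ), sq_nonneg k]
  have hc : Continuous fun θ : ℝ => 1 / Real.sqrt (1 - k ^ 2 * Real.sin θ ^ 2) := by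
    refine continuous_const.div (by fun_prop) fun θ => ?_
    exact (Real.sqrt_pos.2 (hpos θ)).ne'
  have hge : ∀ θ : ℝ, 1 ≤ 1 / Real.sqrt (1 - k ^ 2 * Real.sin θ ^ 2) := fun θ => by
    rw [le_div_iff₀ (Real.sqrt_pos.2 (hpos θ)), one_mul]
    exact Real.sqrt_le_one.2 (by nlinarith [mul_nonneg (sq_nonneg k) (sq_nonneg (Real.sin θ))])
  have hexp : ∀ a b : ℝ, a ≤ b → b - a ≤ ellipticF b k - ellipticF a k := fun a b hab => by
    unfold ellipticF
    rw [intervalIntegral.integral_interval_sub_left (hc.intervalIntegrable _ _)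
      (hc.intervalIntegrable _ _)]
    have h := intervalIntegral.integral_mono_on (μ := MeasureTheory.volume) hab
      ((continuous_const (y := (1 : ℝ))).intervalIntegrable a b)
      (hc.intervalIntegrable a b) (fun θ _ => hge θ)
    simpa using h
  have h0 : ellipticF 0 k = 0 := by simp [ellipticF]
  have hcont : Continuous fun φ => ellipticF φ k :=
    intervalIntegral.continuous_primitive (fun a b => hc.intervalIntegrable a b) 0
  refine ⟨StrictMono.injective fun a b hab => ?_, hcont.surjective ?_ ?_⟩
  · have := hexp a b hab.le
    show ellipticF a k < ellipticF b k
    linarith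
  · refine Filter.tendsto_atTop_mono' _ ?_ Filter.tendsto_id
    filter_upwards [Filter.eventually_ge_atTop 0] with φ hφ
    have := hexp 0 φ hφ
    simp only [id]
    linarith
  · refine Filter.tendsto_atBot_mono' _ ?_ Filter.tendsto_id
    filter_upwards [Filter.eventually_le_atBot 0] with φ hφ
    have := hexp φ 0 hφ
    simp only [id]
    linarith

theorem ellipticF_jacobiAm {k : ℝ} (hk : k ^ 2 < 1) (u : ℝ) :
    ellipticF (jacobiAm u k) k = u :=
  Function.rightInverse_invFun (ellipticF_bijective hk).2 u

theorem jacobiAm_ellipticF {k : ℝ} (hk : k ^ 2 < 1) (φ : ℝ) :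
    jacobiAm (ellipticF φ k) k = φ :=
  Function.leftInverse_invFun (ellipticF_bijective hk).1 φ

end

open Real

/-! ### Elliptic integrals -/

/-! Differentiating the delay integral of an SSPS gives `x'' = -r (sin x(t) - sin x(t-1))`, and
`x(t-1) = -x(t)` turns this into the pendulum equation `x'' = -2r sin x`. An SSPS has an upward zero
and a turning point, so conservation of energy keeps it below the separatrix; uniqueness for the ODE
then makes it a shifted libration of some modulus `k ∈ (0, 1)` (`IsSSPS.eq_pendulumLibration`).

The libration has minimal period `4K(k)/√(2r)`, which must be `2`. Conversely, under this condition
it is antiperiodic with shift `1` and solves the delay equation (`isSSPS_pendulumLibration`).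

Since `K(√a)` increases strictly and continuously from `π/2` to `∞` on `[0, 1)`, the equation `K(√a)
= √(2r)/2` has a root in `(0, 1)`, necessarily unique, exactly when `r > π²/2`. -/

theorem one_sub_mul_sin_sq_pos {m : ℝ} (hm : m < 1) (θ : ℝ) : 0 < 1 - m * sin θ ^ 2 := by
  nlinarith [sin_sq_le_one θ, sq_nonneg (sin θ), mul_nonneg (sub_nonneg.2 hm.le) (sq_nonneg (sin θ)),
    sin_sq_add_cos_sq θ, sq_nonneg (cos θ)]

theorem continuous_ellipticIntegrand {m : ℝ} (hm : m < 1) :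
    Continuous fun θ : ℝ => 1 / √(1 - m * sin θ ^ 2) :=
  continuous_const.div (by fun_prop) fun θ => (sqrt_pos.2 (one_sub_mul_sin_sq_pos hm θ)).ne'

theorem hasDerivAt_ellipticF {k : ℝ} (hk : k ^ 2 < 1) (φ : ℝ) :
    HasDerivAt (fun φ => ellipticF φ k) (1 / √(1 - k ^ 2 * sin φ ^ 2)) φ :=
  ((continuous_ellipticIntegrand hk).integral_hasStrictDerivAt 0 φ).hasDerivAt

theorem strictMono_ellipticF {k : ℝ} (hk : k ^ 2 < 1) : StrictMono fun φ => ellipticF φ k :=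
  strictMono_of_hasDerivAt_pos (hasDerivAt_ellipticF hk) fun φ =>
    one_div_pos.2 (sqrt_pos.2 (one_sub_mul_sin_sq_pos hk φ))

theorem ellipticF_zero (k : ℝ) : ellipticF 0 k = 0 := by simp [ellipticF]

theorem ellipticF_neg (φ k : ℝ) : ellipticF (-φ) k = -ellipticF φ k := by
  have h := intervalIntegral.integral_comp_neg (a := 0) (b := φ)
    (fun θ => 1 / √(1 - k ^ 2 * sin θ ^ 2))
  simp only [sin_neg, neg_sq, neg_zero] at h
  unfold ellipticF
  rw [h, intervalIntegral.integral_symm]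

/-- The integrand has period `π`, and oddness of `F` evaluates its integral over `[-π/2, π/2]` as
`2K`. -/
theorem ellipticF_add_pi {k : ℝ} (hk : k ^ 2 < 1) (φ : ℝ) :
    ellipticF (φ + π) k = ellipticF φ k + 2 * ellipticK k := by
  have hper : Function.Periodic (fun θ => 1 / √(1 - k ^ 2 * sin θ ^ 2)) π := fun θ => by
    simp [sin_add_pi]
  have hc := continuous_ellipticIntegrand hk
  have hsub : ∀ a b, ellipticF b k - ellipticF a k = ∫ θ in a..b, 1 / √(1 - k ^ 2 * sin θ ^ 2) :=
    fun a b => intervalIntegral.integral_interval_sub_left (hc.intervalIntegrable 0 b)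
      (hc.intervalIntegrable 0 a)
  have h' : ellipticF (φ + π) k - ellipticF φ k =
      ellipticF (-(π / 2) + π) k - ellipticF (-(π / 2)) k := by
    rw [hsub, hsub]
    exact hper.intervalIntegral_add_eq φ (-(π / 2))
  rw [ellipticF_neg, show -(π / 2) + π = π / 2 by ring] at h'
  unfold ellipticK
  linarith

theorem ellipticK_pos {k : ℝ} (hk : k ^ 2 < 1) : 0 < ellipticK k := by
  have := strictMono_ellipticF hk (show (0 : ℝ) < π / 2 by positivity)
  simpa [ellipticF_zero, ellipticK] using this

theorem ellipticK_sqrt {a : ℝ} (ha : 0 ≤ a) :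
    ellipticK √a = ∫ θ in (0 : ℝ)..π / 2, 1 / √(1 - a * sin θ ^ 2) := by
  simp [ellipticK, ellipticF, sq_sqrt ha]

theorem ellipticK_sqrt_lt {a b : ℝ} (ha : 0 ≤ a) (hab : a < b) (hb : b < 1) :
    ellipticK √a < ellipticK √b := by
  rw [ellipticK_sqrt ha, ellipticK_sqrt (ha.trans hab.le)]
  refine intervalIntegral.integral_lt_integral_of_continuousOn_of_le_of_exists_lt (by positivity)
    (continuous_ellipticIntegrand (hab.trans hb)).continuousOn
    (continuous_ellipticIntegrand hb).continuousOn (fun θ _ => ?_) ⟨π / 2, Set.right_mem_Icc.2 (by positivity), ?_⟩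
  · refine one_div_le_one_div_of_le (sqrt_pos.2 (one_sub_mul_sin_sq_pos hb θ)) (sqrt_le_sqrt ?_)
    nlinarith [sq_nonneg (sin θ)]
  · refine one_div_lt_one_div_of_lt (sqrt_pos.2 (one_sub_mul_sin_sq_pos hb _))
      (sqrt_lt_sqrt (one_sub_mul_sin_sq_pos hb _).le ?_)
    simp [hab]

theorem ellipticK_sqrt_zero : ellipticK √0 = π / 2 := by
  rw [ellipticK_sqrt le_rfl]
  simp

/-- The radicand is `cos² θ + ε² sin² θ ≤ (π/2 - θ + ε)²`, so the integrand dominates `1/(π/2 + ε -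
θ)`. This makes `K` diverge as `ε → 0`. -/
theorem log_le_ellipticK_sqrt {ε : ℝ} (hε : 0 < ε) (hε1 : ε < 1) :
    log ((π / 2 + ε) / ε) ≤ ellipticK √(1 - ε ^ 2) := by
  have ha : 0 ≤ 1 - ε ^ 2 := by nlinarith
  have ha1 : 1 - ε ^ 2 < 1 := by nlinarith
  have hsub := intervalIntegral.integral_comp_sub_left (a := 0) (b := π / 2)
    (fun y : ℝ => y⁻¹) (π / 2 + ε)
  rw [show π / 2 + ε - π / 2 = ε by ring, sub_zero,
    integral_inv_of_pos hε (by positivity)] at hsub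
  rw [ellipticK_sqrt ha, ← hsub]
  refine intervalIntegral.integral_mono_on (by positivity) ?_
    ((continuous_ellipticIntegrand ha1).intervalIntegrable _ _) fun θ hθ => ?_
  · refine ContinuousOn.intervalIntegrable (ContinuousOn.inv₀ (by fun_prop) fun θ hθ => ?_)
    rw [Set.uIcc_of_le (by positivity)] at hθ
    have := hθ.2
    linarith
  · have h1 := hθ.2
    have hc : cos θ ≤ π / 2 - θ := by
      rw [← sin_pi_div_two_sub]; exact sin_le (by linarith)
    have hc0 : 0 ≤ cos θ := cos_nonneg_of_mem_Icc ⟨by linarith [hθ.1, pi_pos], h1⟩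
    rw [← one_div]
    refine one_div_le_one_div_of_le (sqrt_pos.2 (one_sub_mul_sin_sq_pos ha1 θ)) ?_
    rw [sqrt_le_left (by linarith)]
    have hs := sin_sq_add_cos_sq θ
    have hs1 := sin_sq_le_one θ
    have : 1 - (1 - ε ^ 2) * sin θ ^ 2 = cos θ ^ 2 + ε ^ 2 * sin θ ^ 2 := by linarith
    have h2 : ε ^ 2 * sin θ ^ 2 ≤ ε ^ 2 := mul_le_of_le_one_right (sq_nonneg _) hs1
    nlinarith [pow_le_pow_left₀ (add_nonneg hc0 hε.le) (add_le_add_left hc ε) 2,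
      mul_nonneg hc0 hε.le]

theorem exists_le_ellipticK_sqrt (C : ℝ) : ∃ b ∈ Set.Ioo (0 : ℝ) 1, C ≤ ellipticK √b := by
  -- Chosen so that `-log ε = |C| + 1` already exceeds `C`.
  set ε := exp (-(|C| + 1)) with hεd
  have hε : 0 < ε := exp_pos _
  have hε1 : ε < 1 := by rw [hεd, exp_lt_one_iff]; linarith [abs_nonneg C]
  refine ⟨1 - ε ^ 2, ⟨by nlinarith, by nlinarith⟩, le_trans ?_ (log_le_ellipticK_sqrt hε hε1)⟩
  rw [log_div (by positivity) hε.ne', hεd, log_exp]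
  have : 0 ≤ log (π / 2 + exp (-(|C| + 1))) :=
    log_nonneg (by linarith [two_le_pi, exp_pos (-(|C| + 1))])
  linarith [le_abs_self C]

theorem continuousOn_ellipticK_sqrt {b : ℝ} (hb : b < 1) :
    ContinuousOn (fun a => ellipticK √a) (Set.Icc 0 b) := by
  -- Truncating `a` at `b` makes the integrand jointly continuous on the whole plane.
  have hpos : ∀ a θ : ℝ, 0 < 1 - min a b * sin θ ^ 2 := fun a θ =>
    one_sub_mul_sin_sq_pos ((min_le_right a b).trans_lt hb) θ
  have hc : Continuous (Function.uncurry fun a θ : ℝ => 1 / √(1 - min a b * sin θ ^ 2)) :=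
    continuous_const.div (by fun_prop) fun p => (sqrt_pos.2 (hpos p.1 p.2)).ne'
  refine (intervalIntegral.continuous_parametric_intervalIntegral_of_continuous'
    (μ := MeasureTheory.volume) hc 0 (π / 2)).continuousOn.congr fun a ha => ?_
  simp only [ellipticK_sqrt ha.1, min_eq_left ha.2]

theorem exists_ellipticK_sqrt_eq {C : ℝ} (hC : π / 2 < C) :
    ∃ a ∈ Set.Ioo (0 : ℝ) 1, ellipticK √a = C := by
  obtain ⟨b, hb, hCb⟩ := exists_le_ellipticK_sqrt C
  obtain ⟨a, ha, rfl⟩ := intermediate_value_Icc hb.1.le (continuousOn_ellipticK_sqrt hb.2)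
    ⟨by simpa only [ellipticK_sqrt_zero] using hC.le, hCb⟩
  refine ⟨a, ⟨ha.1.lt_of_ne ?_, ha.2.trans_lt hb.2⟩, rfl⟩
  rintro rfl
  exact hC.ne' ellipticK_sqrt_zero

theorem ellipticK_sqrt_injOn : Set.InjOn (fun a => ellipticK √a) (Set.Ioo 0 1) := by
  intro a ha b hb h
  rcases lt_trichotomy a b with hab | hab | hab
  · exact absurd h (ellipticK_sqrt_lt ha.1.le hab hb.2).ne
  · exact hab
  · exact absurd h (ellipticK_sqrt_lt hb.1.le hab ha.2).ne'

/-! ### The Jacobi amplitude -/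

theorem continuous_jacobiAm {k : ℝ} (hk : k ^ 2 < 1) : Continuous fun u => jacobiAm u k := by
  let e := (strictMono_ellipticF hk).orderIsoOfSurjective _ (ellipticF_bijective hk).2
  convert e.symm.continuous using 1
  funext u
  rw [e.eq_symm_apply]
  exact ellipticF_jacobiAm hk u

theorem hasDerivAt_jacobiAm {k : ℝ} (hk : k ^ 2 < 1) (u : ℝ) :
    HasDerivAt (fun u => jacobiAm u k) √(1 - k ^ 2 * sin (jacobiAm u k) ^ 2) u := by
  have hs := sqrt_pos.2 (one_sub_mul_sin_sq_pos hk (jacobiAm u k))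
  have h := HasDerivAt.of_local_left_inverse (continuous_jacobiAm hk).continuousAt
    (hasDerivAt_ellipticF hk (jacobiAm u k)) (one_div_pos.2 hs).ne'
    (Filter.Eventually.of_forall (ellipticF_jacobiAm hk))
  simpa using h

theorem jacobiAm_zero {k : ℝ} (hk : k ^ 2 < 1) : jacobiAm 0 k = 0 := by
  simpa [ellipticF_zero] using jacobiAm_ellipticF hk 0

theorem jacobiAm_add_two_mul_ellipticK {k : ℝ} (hk : k ^ 2 < 1) (u : ℝ) :
    jacobiAm (u + 2 * ellipticK k) k = jacobiAm u k + π := by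
  apply (ellipticF_bijective hk).1
  simp only [ellipticF_jacobiAm hk, ellipticF_add_pi hk]

theorem ellipticF_int_mul_pi {k : ℝ} (hk : k ^ 2 < 1) (n : ℤ) :
    ellipticF (n * π) k = n * (2 * ellipticK k) := by
  induction n using Int.induction_on with
  | zero => simp [ellipticF_zero]
  | succ i ih =>
    push_cast at ih ⊢
    rw [add_one_mul, ellipticF_add_pi hk, ih]; ring
  | pred i ih =>
    push_cast at ih ⊢
    have := ellipticF_add_pi hk ((-(i : ℝ) - 1) * π)
    rw [show (-(i : ℝ) - 1) * π + π = -(i : ℝ) * π by ring, ih] at this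
    linarith

/-! ### Librations of the pendulum -/

/-- The solution of `x'' = -ω² sin x` with `x 0 = 0` and `x' 0 = 2 k ω`. -/
noncomputable def pendulumLibration (ω k t : ℝ) : ℝ := 2 * arcsin (k * jacobiSn (ω * t) k)

theorem hasDerivAt_pendulumLibration {k : ℝ} (hk : k ^ 2 < 1) (ω t : ℝ) :
    HasDerivAt (pendulumLibration ω k) (2 * k * ω * cos (jacobiAm (ω * t) k)) t := by
  have hp := one_sub_mul_sin_sq_pos hk (jacobiAm (ω * t) k)
  have ham : HasDerivAt (fun t => jacobiAm (ω * t) k) _ t :=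
    (hasDerivAt_jacobiAm hk (ω * t)).comp t ((hasDerivAt_id t).const_mul ω)
  have hlt : (k * sin (jacobiAm (ω * t) k)) ^ 2 < 1 := by rw [mul_pow]; linarith
  have has := (hasDerivAt_arcsin (x := k * sin (jacobiAm (ω * t) k))
    (by rintro h; rw [h] at hlt; norm_num at hlt) (by rintro h; rw [h] at hlt; norm_num at hlt))
  have h := ((has.comp t (ham.sin.const_mul k)).const_mul 2)
  refine h.congr_deriv ?_
  have hs := sqrt_pos.2 hp
  rw [mul_pow]
  field_simp

theorem sin_pendulumLibration {k : ℝ} (hk : k ^ 2 < 1) (ω t : ℝ) :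
    sin (pendulumLibration ω k t) = 2 * k * sin (jacobiAm (ω * t) k) *
      √(1 - k ^ 2 * sin (jacobiAm (ω * t) k) ^ 2) := by
  have hp := one_sub_mul_sin_sq_pos hk (jacobiAm (ω * t) k)
  have hlt : |k * sin (jacobiAm (ω * t) k)| ≤ 1 := by
    rw [← sq_le_one_iff_abs_le_one, mul_pow]; linarith
  rw [pendulumLibration, sin_two_mul, cos_arcsin, jacobiSn,
    sin_arcsin (abs_le.1 hlt).1 (abs_le.1 hlt).2, mul_pow]
  ring

theorem hasDerivAt_velocity_pendulumLibration {k : ℝ} (hk : k ^ 2 < 1) (ω t : ℝ) :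
    HasDerivAt (fun t => 2 * k * ω * cos (jacobiAm (ω * t) k))
      (-ω ^ 2 * sin (pendulumLibration ω k t)) t := by
  have ham : HasDerivAt (fun t => jacobiAm (ω * t) k) _ t :=
    (hasDerivAt_jacobiAm hk (ω * t)).comp t ((hasDerivAt_id t).const_mul ω)
  refine (ham.cos.const_mul (2 * k * ω)).congr_deriv ?_
  rw [sin_pendulumLibration hk]
  ring

theorem pendulumLibration_zero {k : ℝ} (hk : k ^ 2 < 1) (ω : ℝ) :
    pendulumLibration ω k 0 = 0 := by
  simp [pendulumLibration, jacobiSn, jacobiAm_zero hk]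

theorem pendulumLibration_antiperiodic {ω k : ℝ} (hω : 0 < ω) (hk : k ^ 2 < 1) :
    Function.Antiperiodic (pendulumLibration ω k) (2 * ellipticK k / ω) := fun t => by
  rw [pendulumLibration, mul_add, mul_div_cancel₀ _ hω.ne', jacobiSn,
    jacobiAm_add_two_mul_ellipticK hk, sin_add_pi, mul_neg, arcsin_neg, pendulumLibration, jacobiSn,
    mul_neg]

theorem pendulumLibration_periodic {ω k : ℝ} (hω : 0 < ω) (hk : k ^ 2 < 1) :
    Function.Periodic (pendulumLibration ω k) (4 * ellipticK k / ω) := by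
  rw [show 4 * ellipticK k / ω = 2 * (2 * ellipticK k / ω) by ring]
  exact (pendulumLibration_antiperiodic hω hk).periodic_two_mul

/-- A period restores the initial velocity `2kω`, so the amplitude at `ωT` is `2πn`. Hence `ωT =
4nK`, with `n ≥ 1` because `T > 0`. -/
theorem period_pendulumLibration_le {ω k T : ℝ} (hω : 0 < ω) (hk0 : 0 < k) (hk : k ^ 2 < 1)
    (hT0 : 0 < T) (hT : Function.Periodic (pendulumLibration ω k) T) :
    4 * ellipticK k / ω ≤ T := by
  have hd := (hasDerivAt_pendulumLibration hk ω (0 + T)).comp_add_const 0 T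
  have hfun : (fun t => pendulumLibration ω k (t + T)) = pendulumLibration ω k := funext hT
  rw [hfun] at hd
  have hu := hd.unique (hasDerivAt_pendulumLibration hk ω 0)
  rw [mul_zero, jacobiAm_zero hk, cos_zero, zero_add] at hu
  have hcos : cos (jacobiAm (ω * T) k) = 1 :=
    mul_left_cancel₀ (by positivity : 2 * k * ω ≠ 0) hu
  obtain ⟨n, hn⟩ := (cos_eq_one_iff _).1 hcos
  have hF := ellipticF_jacobiAm hk (ω * T)
  have h2 := ellipticF_int_mul_pi hk (n * 2)
  rw [← hn, ← mul_assoc] at hF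
  push_cast at h2
  rw [h2] at hF
  have hK := ellipticK_pos hk
  have hn1 : 1 ≤ n := by
    by_contra! h
    have : (n : ℝ) ≤ 0 := by exact_mod_cast (by omega : n ≤ 0)
    nlinarith [mul_pos hω hT0]
  have hn1' : (1 : ℝ) ≤ n := by exact_mod_cast hn1
  rw [div_le_iff₀ hω]
  nlinarith

theorem isLeast_period_pendulumLibration {ω k : ℝ} (hω : 0 < ω) (hk0 : 0 < k) (hk : k ^ 2 < 1) :
    IsLeast {T : ℝ | 0 < T ∧ Function.Periodic (pendulumLibration ω k) T}
      (4 * ellipticK k / ω) :=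
  ⟨⟨by have := ellipticK_pos hk; positivity, pendulumLibration_periodic hω hk⟩,
    fun _ hT => period_pendulumLibration_le hω hk0 hk hT.1 hT.2⟩

/-! ### The pendulum equation -/

theorem pendulum_solution_unique {c : ℝ} {x v y w : ℝ → ℝ} {t₀ : ℝ}
    (hx : ∀ t, HasDerivAt x (v t) t) (hv : ∀ t, HasDerivAt v (c * sin (x t)) t)
    (hy : ∀ t, HasDerivAt y (w t) t) (hw : ∀ t, HasDerivAt w (c * sin (y t)) t)
    (h0 : x t₀ = y t₀) (h1 : v t₀ = w t₀) : x = y := by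
  have hlip : LipschitzWith (max 1 (‖c‖₊ * 1)) fun p : ℝ × ℝ => (p.2, c * sin p.1) := by
    refine LipschitzWith.prodMk LipschitzWith.prod_snd ?_
    have := (lipschitzWith_smul c).comp (lipschitzWith_sin.comp (LipschitzWith.prod_fst (α := ℝ) (β := ℝ)))
    simpa [Function.comp_def] using this
  have := ODE_solution_unique_univ (v := fun _ (p : ℝ × ℝ) => (p.2, c * sin p.1))
    (s := fun _ => Set.univ) (f := fun t => (x t, v t)) (g := fun t => (y t, w t)) (t₀ := t₀)
    (fun _ => hlip.lipschitzOnWith)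
    (fun t => ⟨(hx t).prodMk (hv t), trivial⟩) (fun t => ⟨(hy t).prodMk (hw t), trivial⟩)
    (by simp [h0, h1])
  funext t
  exact congrArg Prod.fst (congrFun this t)

theorem pendulum_energy {r : ℝ} {x v : ℝ → ℝ}
    (hx : ∀ t, HasDerivAt x (v t) t) (hv : ∀ t, HasDerivAt v (-(2 * r) * sin (x t)) t) (s t : ℝ) :
    v s ^ 2 - 4 * r * cos (x s) = v t ^ 2 - 4 * r * cos (x t) := by
  have h : ∀ t, HasDerivAt (fun t => v t ^ 2 - 4 * r * cos (x t)) 0 t := fun t =>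
    (((hv t).pow 2).sub ((hx t).cos.const_mul (4 * r))).congr_deriv (by simp; ring)
  exact is_const_of_deriv_eq_zero (fun t => (h t).differentiableAt) (fun t => (h t).deriv) s t
/-! ### Reduction of the delay equation to the pendulum equation -/

theorem integral_delay (g : ℝ → ℝ) (t : ℝ) :
    ∫ s in (0 : ℝ)..1, g (t - s) = ∫ s in t - 1..t, g s := by
  simp

theorem IsSSPS.hasDerivAt_velocity {r : ℝ} {x : ℝ → ℝ} (h : IsSSPS (fun u => r * sin u) x)
    (t : ℝ) :
    HasDerivAt (fun t => -∫ s in (0 : ℝ)..1, r * sin (x (t - s))) (-(2 * r) * sin (x t)) t := by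
  have hxc : Continuous x := continuous_iff_continuousAt.2 fun t => (h.isSolution t).continuousAt
  have hg : Continuous fun s => r * sin (x s) := by fun_prop
  have hprim := fun t => (hg.integral_hasStrictDerivAt 0 t).hasDerivAt
  have hd := ((hprim t).sub ((hprim (t - 1)).comp_sub_const t 1)).neg
  have hx1 : x (t - 1) = -x t := by linarith [h.symmetric t]
  refine (hd.congr_deriv (by rw [hx1, sin_neg]; ring)).congr_of_eventuallyEq
    (Filter.Eventually.of_forall fun u => ?_)
  have := integral_delay (fun s => r * sin (x s)) u
  simp only [Pi.neg_apply, Pi.sub_apply]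
  rw [this, intervalIntegral.integral_interval_sub_left (hg.intervalIntegrable _ _)
    (hg.intervalIntegrable _ _)]

/-- The velocity is antiperiodic too, so integrating `v'` over `[t-1, t]` gives `2 v(t)`. -/
theorem isSolutionDDE_of_pendulum {r : ℝ} {x v : ℝ → ℝ} (hx : ∀ t, HasDerivAt x (v t) t)
    (hv : ∀ t, HasDerivAt v (-(2 * r) * sin (x t)) t) (hanti : Function.Antiperiodic x 1) :
    IsSolutionDDE (fun u => r * sin u) x := fun t => by
  have hxc : Continuous x := continuous_iff_continuousAt.2 fun t => (hx t).continuousAt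
  have hvanti : v t = -v (t - 1) := by
    have h1 : HasDerivAt (fun s => x (s + 1)) (v t) (t - 1) := by
      simpa using (hx (t - 1 + 1)).comp_add_const (t - 1) 1
    rw [show (fun s => x (s + 1)) = fun s => -x s from funext hanti] at h1
    exact h1.unique (hx (t - 1)).neg
  have hint := intervalIntegral.integral_eq_sub_of_hasDerivAt (a := t - 1) (b := t)
    (fun s _ => hv s) (Continuous.intervalIntegrable (by fun_prop) _ _)
  rw [intervalIntegral.integral_const_mul] at hint
  refine (hx t).congr_deriv ?_
  rw [integral_delay (fun s => r * sin (x s)), intervalIntegral.integral_const_mul]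
  linarith

/-! ### Existence and classification of SSPS -/

theorem isSSPS_pendulumLibration {r a : ℝ} (hr : 0 < r) (ha : a ∈ Set.Ioo (0 : ℝ) 1)
    (hK : 2 * ellipticK √a / √(2 * r) = 1) :
    IsSSPS (fun u => r * sin u) (pendulumLibration √(2 * r) √a) := by
  have hk : √a ^ 2 < 1 := by rw [sq_sqrt ha.1.le]; exact ha.2
  have hω : 0 < √(2 * r) := by positivity
  have hanti := pendulumLibration_antiperiodic hω hk
  rw [hK] at hanti
  refine ⟨isSolutionDDE_of_pendulum (hasDerivAt_pendulumLibration hk _) (fun t => ?_) hanti, ?_,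
    fun t => ?_⟩
  · simpa only [sq_sqrt (by positivity : 0 ≤ 2 * r)] using
      hasDerivAt_velocity_pendulumLibration hk √(2 * r) t
  · have := isLeast_period_pendulumLibration hω (sqrt_pos.2 ha.1) hk
    rwa [show 4 * ellipticK √a / √(2 * r) = 2 * (2 * ellipticK √a / √(2 * r)) by ring, hK,
      mul_one] at this
  · have := hanti (t - 1)
    rw [sub_add_cancel] at this
    linarith

theorem IsSSPS.not_const {f x : ℝ → ℝ} (h : IsSSPS f x) (c : ℝ) : ¬ ∀ t, x t = c := fun hc => by
  have := h.minimalPeriod.2 (show (1 : ℝ) ∈ _ from ⟨one_pos, fun t => by rw [hc, hc]⟩)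
  norm_num at this

theorem IsSSPS.exists_zero {f x : ℝ → ℝ} (h : IsSSPS f x) : ∃ t, x t = 0 := by
  have hxc : Continuous x := continuous_iff_continuousAt.2 fun t => (h.isSolution t).continuousAt
  have h0 := h.symmetric 0
  rcases le_total 0 (x 0) with hx | hx
  · exact intermediate_value_univ (0 - 1) 0 hxc ⟨by linarith, hx⟩
  · exact intermediate_value_univ 0 (0 - 1) hxc ⟨hx, by linarith⟩

theorem IsSSPS.eq_pendulumLibration {r : ℝ} (hr : 0 < r) {x : ℝ → ℝ}
    (h : IsSSPS (fun u => r * sin u) x) :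
    ∃ a ∈ Set.Ioo (0 : ℝ) 1, 2 * ellipticK √a / √(2 * r) = 1 ∧
      ∃ t₀, ∀ t, x t = pendulumLibration √(2 * r) √a (t + t₀) := by
  obtain ⟨v, hx, hv⟩ : ∃ v : ℝ → ℝ, (∀ t, HasDerivAt x (v t) t) ∧
      ∀ t, HasDerivAt v (-(2 * r) * sin (x t)) t := ⟨_, h.isSolution, h.hasDerivAt_velocity⟩
  have hxc : Continuous x := continuous_iff_continuousAt.2 fun t => (hx t).continuousAt
  -- A point of rest over a zero of `sin` would force the solution to be constant.
  have hrest : ∀ t, sin (x t) = 0 → v t ≠ 0 := fun t hs hvt => by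
    refine h.not_const (x t) fun s => congrFun (pendulum_solution_unique (t₀ := t) hx hv
      (y := fun _ => x t) (w := fun _ => 0) (fun u => hasDerivAt_const u _) (fun u => ?_) rfl hvt) s
    simpa [hs] using hasDerivAt_const u (0 : ℝ)
  have hvanti : ∀ t, v (t - 1) = -v t := fun t => by
    have h1 := (hx (t - 1)).comp_sub_const t 1
    rw [show (fun s => x (s - 1)) = fun s => -x s from
      funext fun s => by linarith [h.symmetric s]] at h1
    exact h1.unique (hx t).neg
  -- A shift by `1` turns a downward zero into an upward one.
  obtain ⟨t₁, hx1, hv1⟩ : ∃ t, x t = 0 ∧ 0 < v t := by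
    obtain ⟨t, ht⟩ := h.exists_zero
    rcases (hrest t (by simp [ht])).lt_or_gt with hneg | hpos
    · exact ⟨t - 1, by linarith [h.symmetric t], by rw [hvanti]; linarith⟩
    · exact ⟨t, ht, hpos⟩
  -- Rolle over one period gives a turning point `c`, where energy reads `v(t₁)² = 4r (1 - cos
  -- x(c))`; `cos x(c) = -1` would be a point of rest.
  have henergy : v t₁ ^ 2 < 8 * r := by
    obtain ⟨c, -, hc⟩ := exists_hasDerivAt_eq_zero (show t₁ < t₁ + 2 by linarith)
      hxc.continuousOn (h.minimalPeriod.1.2 t₁).symm fun t _ => hx t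
    have he := pendulum_energy hx hv c t₁
    rw [hc, hx1, cos_zero] at he
    have hcos : -1 < cos (x c) := (neg_one_le_cos _).lt_of_ne fun hcos => by
      refine hrest c ?_ hc
      have := sin_sq_add_cos_sq (x c)
      rw [← hcos] at this
      nlinarith
    nlinarith
  have hω : 0 < √(2 * r) := by positivity
  have hω2 : √(2 * r) ^ 2 = 2 * r := sq_sqrt (by positivity)
  -- The modulus that matches the libration's initial velocity `2kω` with `v t₁`; the energy bound
  -- becomes `k² < 1`.
  set k := v t₁ / (2 * √(2 * r)) with hkd
  have hk0 : 0 < k := by positivity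
  have hk : k ^ 2 < 1 := by
    rw [hkd, div_pow, mul_pow, hω2, div_lt_one (by positivity)]
    linarith
  have hxeq : ∀ t, x t = pendulumLibration √(2 * r) k (t + -t₁) := by
    refine congrFun (pendulum_solution_unique (t₀ := t₁) hx hv
      (fun t => (hasDerivAt_pendulumLibration hk √(2 * r) (t + -t₁)).comp_add_const t (-t₁))
      (fun t => ?_) ?_ ?_)
    · have := (hasDerivAt_velocity_pendulumLibration hk √(2 * r) (t + -t₁)).comp_add_const t (-t₁)
      rwa [hω2] at this
    · rw [add_neg_cancel, hx1, pendulumLibration_zero hk]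
    · rw [add_neg_cancel, mul_zero, jacobiAm_zero hk, cos_zero, hkd]
      field_simp
  have hper : {T : ℝ | 0 < T ∧ Function.Periodic x T} =
      {T : ℝ | 0 < T ∧ Function.Periodic (pendulumLibration √(2 * r) k) T} := by
    ext T
    refine and_congr_right fun _ => ⟨fun hT t => ?_, fun hT t => ?_⟩
    · have := hT (t + t₁)
      rw [hxeq, hxeq] at this
      convert this using 2 <;> ring
    · rw [hxeq, hxeq, add_right_comm, hT]
  have hT := h.minimalPeriod
  rw [hper] at hT
  have hK := (isLeast_period_pendulumLibration hω hk0 hk).unique hT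
  refine ⟨k ^ 2, ⟨by positivity, hk⟩, ?_, -t₁, ?_⟩
  · rw [sqrt_sq hk0.le]
    linear_combination hK / 2
  · rwa [sqrt_sq hk0.le]

theorem theorem4 (r : ℝ) (hr : 0 < r) :
    ((∃ x : ℝ → ℝ, IsSSPS (fun u => r * Real.sin u) x) ↔ Real.pi ^ 2 / 2 < r) ∧
    (Real.pi ^ 2 / 2 < r →
      (∃! a : ℝ, a ∈ Set.Ioo (0 : ℝ) 1 ∧
        2 * ellipticK (Real.sqrt a) / Real.sqrt (2 * r) = 1) ∧
      ∀ a ∈ Set.Ioo (0 : ℝ) 1, 2 * ellipticK (Real.sqrt a) / Real.sqrt (2 * r) = 1 →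
        IsSSPS (fun u => r * Real.sin u) (fun t =>
          2 * Real.arcsin (Real.sqrt a * jacobiSn (Real.sqrt (2 * r) * t) (Real.sqrt a))) ∧
        ∀ x : ℝ → ℝ, IsSSPS (fun u => r * Real.sin u) x →
          ∃ t₀ : ℝ, ∀ t : ℝ, x t =
            2 * Real.arcsin
              (Real.sqrt a * jacobiSn (Real.sqrt (2 * r) * (t + t₀)) (Real.sqrt a))) := by
  have hω : 0 < √(2 * r) := by positivity
  have hiff : ∀ a, 2 * ellipticK √a / √(2 * r) = 1 ↔ ellipticK √a = √(2 * r) / 2 := fun a => by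
    rw [div_eq_one_iff_eq hω.ne', eq_div_iff two_ne_zero, mul_comm]
  have hthreshold : π / 2 < √(2 * r) / 2 ↔ π ^ 2 / 2 < r := by
    rw [div_lt_div_iff_of_pos_right two_pos, lt_sqrt pi_pos.le, div_lt_iff₀' two_pos]
  have hunique : ∀ a ∈ Set.Ioo (0 : ℝ) 1, ∀ b ∈ Set.Ioo (0 : ℝ) 1,
      2 * ellipticK √a / √(2 * r) = 1 → 2 * ellipticK √b / √(2 * r) = 1 → a = b :=
    fun a ha b hb hKa hKb =>
      ellipticK_sqrt_injOn ha hb (((hiff a).1 hKa).trans ((hiff b).1 hKb).symm)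
  refine ⟨⟨fun ⟨x, hx⟩ => ?_, fun h => ?_⟩, fun h => ⟨?_, fun a ha hK =>
    ⟨isSSPS_pendulumLibration hr ha hK, fun x hx => ?_⟩⟩⟩
  · obtain ⟨a, ha, hK, -⟩ := hx.eq_pendulumLibration hr
    rw [← hthreshold, ← (hiff a).1 hK, ← ellipticK_sqrt_zero]
    exact ellipticK_sqrt_lt le_rfl ha.1 ha.2
  · obtain ⟨a, ha, hK⟩ := exists_ellipticK_sqrt_eq (hthreshold.2 h)
    exact ⟨_, isSSPS_pendulumLibration hr ha ((hiff a).2 hK)⟩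
  · obtain ⟨a, ha, hK⟩ := exists_ellipticK_sqrt_eq (hthreshold.2 h)
    exact ⟨a, ⟨ha, (hiff a).2 hK⟩, fun b hb => hunique b hb.1 a ha hb.2 ((hiff a).2 hK)⟩
  · obtain ⟨b, hb, hKb, t₀, ht₀⟩ := hx.eq_pendulumLibration hr
    obtain rfl := hunique a ha b hb hK hKb
    exact ⟨t₀, ht₀⟩
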